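/- All functions are real measurable functions on $(0,\infty)$ with Lebesgue measure, identified when equal a.e. Write $f^*(t)=\inf\{s\ge 0: |\{|f|>s\}|\le t\}$ for the decreasing rearrangement, $f^{**}(t)=\frac1t\int_0^t f^*(s)\,ds$, $Sf(t)=\frac1t\int_0^t f(s)\,ds$, and $f\prec g$ if $\int_0^t f^*\le\int_0^t g^*$ for all $t>0$. Consider a functional $\|\cdot\|_X$ on all measurable functions with values in $[0,\infty]$, the space $X=\{f:\|f\|_X<\infty\}$, and the properties - (P1) $\|\cdot\|_X$ is a norm; - (P2) $f^*\le g^*$ implies $\|f\|_X\le\|g\|_X$; - (P3) $0\le f_n\uparrow f$ a.e. implies $\|f_n\|_X\uparrow\|f\|_X$; - (P4) $|E|<\infty$ implies $\|\chi_E\|_X<\infty$; - (P5) if $|E|<\infty$ there is $C_E<\infty$ with $\int_E|f|\le C_E\|f\|_X$ for all $f$; - (P2$^*$) $f\prec g$ implies $\|f\|_X\le\|g\|_X$; - (P3$^*$) if $\sum_n\|f_n\|_X<\infty$, then $\sum_n f_n$ converges in $X$ to some $f\in X$ with $\|f\|_X\le\sum_n\|f_n\|_X$. $X$ is an r.i.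 space if (P1)–(P5) hold, and an r.i. monotone Riesz–Fischer space if (P1), (P2), (P2$^*$), (P3$^*$), (P4), (P5) hold. **Theorem.** Let $X$ be an r.i. space and let $T:X\to L^1+L^\infty$ be a linear operator of class $\mathcal H$, that is: (i) $T$ maps positive decreasing functions in $X$ to positive decreasing functions; (ii) $Tf\prec Tf^*$ for all $f\in X$; (iii) $S\chi_{(0,t)}\le ST\chi_{(0,t)}$ on $(0,\infty)$ for all $t>0$. Let $$\mathfrak R[T,X]_0=\{f\in L^1+L^\infty: f^{**}\le (Tg^*)^{**}\text{ for some } g\in X\},\qquad \|f\|_{\mathfrak R[T,X]_0}=\inf\{\|g\|_X: g\in X,\ f^{**}\le (Tg^*)^{**}\}.$$ Then $\mathfrak R[T,X]_0$ is the optimal range of $T$ on $X$ among r.i. monotone Riesz–Fischer spaces: it is an r.i. monotone Riesz–Fischer space, $T:X\to\mathfrak R[T,X]_0$ is bounded, and whenever $Y$ is an r.i. monotone Riesz–Fischer space such that $T$ maps $X$ boundedly into $Y$, then $\mathfrak R[T,X]_0\subseteq Y$ with continuous inclusion. -/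

import Mathlib

open MeasureTheory Set Filter Topology
open scoped ENNReal NNReal

namespace OptimalRange

/-- Lebesgue measure on the half line `(0, ∞)`. -/
noncomputable abbrev halfLine : Measure ℝ := volume.restrict (Ioi 0)

/-- Real measurable functions on `(0, ∞)`, up to equality almost everywhere. -/
abbrev L0 : Type := ℝ →ₘ[halfLine] ℝ

/-- The decreasing rearrangement `f*(t) = inf {s ≥ 0 : |{|f| > s}| ≤ t}`, with values
in `[0, ∞]`; it is meant for `t > 0`. -/
noncomputable def rearr (f : L0) (t : ℝ) : ℝ≥0∞ :=
  sInf {s : ℝ≥0∞ | halfLine {x | s < ‖f x‖ₑ} ≤ ENNReal.ofReal t}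

lemma rearr_antitone (f : L0) : Antitone (rearr f) := by
  intro a b hab
  exact sInf_le_sInf fun s hs => le_trans hs (ENNReal.ofReal_le_ofReal hab)

lemma measurable_rearr_toReal (f : L0) : Measurable fun t => (rearr f t).toReal :=
  (rearr_antitone f).measurable.ennreal_toReal

/-- The decreasing rearrangement `f*` as a real measurable function on `(0, ∞)`. It is used only
where `f*` is finite on `(0, ∞)`. -/
noncomputable def rearrFun (f : L0) : L0 :=
  AEEqFun.mk (fun t => (rearr f t).toReal) (measurable_rearr_toReal f).aestronglyMeasurable

/-- The maximal function `f**(t) = t⁻¹ ∫₀ᵗ f*(s) ds`. -/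
noncomputable def maxFun (f : L0) (t : ℝ) : ℝ≥0∞ :=
  (ENNReal.ofReal t)⁻¹ * ∫⁻ s in Ioo 0 t, rearr f s

/-- The Hardy–Littlewood–Pólya relation `f ≺ g`. -/
def HLP (f g : L0) : Prop :=
  ∀ t : ℝ, 0 < t → ∫⁻ s in Ioo 0 t, rearr f s ≤ ∫⁻ s in Ioo 0 t, rearr g s

/-- The characteristic function of a measurable set. -/
noncomputable def charFn (E : Set ℝ) (hE : MeasurableSet E) : L0 :=
  AEEqFun.mk (E.indicator fun _ => (1 : ℝ))
    ((measurable_const.indicator hE).aestronglyMeasurable)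

/-- `f` is (a.e. equal to) a nonnegative nonincreasing function on `(0, ∞)`. -/
def IsPosDecr (f : L0) : Prop :=
  ∃ φ : ℝ → ℝ, AntitoneOn φ (Ioi 0) ∧ (∀ t, 0 < t → 0 ≤ φ t) ∧ f =ᵐ[halfLine] φ

/-- The Hardy operator `S f (t) = t⁻¹ ∫₀ᵗ f(s) ds`. -/
noncomputable def hardy (f : L0) (t : ℝ) : ℝ :=
  t⁻¹ * ∫ s in Ioo 0 t, f s ∂halfLine

/-- The space `L¹ + L^∞` on `(0, ∞)`. -/
noncomputable def L1Linf : Submodule ℝ L0 :=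
  Lp.LpSubmodule ℝ ℝ 1 halfLine ⊔ Lp.LpSubmodule ℝ ℝ ∞ halfLine

/-- The properties common to r.i. Banach function spaces and r.i. Riesz–Fischer spaces, for a
functional `ρ` on all measurable functions; the space is `{f : ρ f < ∞}`. -/
structure IsRINorm (ρ : L0 → ℝ≥0∞) : Prop where
  /-- (P1) `ρ` is a norm. -/
  eq_zero_iff : ∀ f, ρ f = 0 ↔ f = 0
  smul : ∀ (c : ℝ) (f : L0), ρ (c • f) = ‖c‖ₑ * ρ f
  add_le : ∀ f g, ρ (f + g) ≤ ρ f + ρ g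
  /-- (P2) `f* ≤ g*` implies `ρ f ≤ ρ g`. -/
  mono : ∀ f g, (∀ t : ℝ, 0 < t → rearr f t ≤ rearr g t) → ρ f ≤ ρ g
  /-- (P4) Characteristic functions of sets of finite measure have finite norm. -/
  charFn_lt_top : ∀ (E : Set ℝ) (hE : MeasurableSet E), halfLine E < ∞ → ρ (charFn E hE) < ∞
  /-- (P5) The norm controls integrals over sets of finite measure. -/
  setLIntegral_le : ∀ E : Set ℝ, MeasurableSet E → halfLine E < ∞ →
    ∃ C : ℝ≥0, ∀ f : L0, ∫⁻ x in E, ‖f x‖ₑ ∂halfLine ≤ C * ρ f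

/-- `ρ` is the norm of a rearrangement invariant Banach function space: (P1), (P2), (P4), (P5)
and the Fatou property (P3). -/
structure IsRISpace (ρ : L0 → ℝ≥0∞) : Prop extends IsRINorm ρ where
  fatou : ∀ (f : ℕ → L0) (g : L0), (∀ n, 0 ≤ f n) → Monotone f →
    (∀ᵐ x ∂halfLine, Tendsto (fun n => f n x) atTop (𝓝 (g x))) →
    Tendsto (fun n => ρ (f n)) atTop (𝓝 (ρ g))

/-- `ρ` is the norm of a rearrangement invariant monotone Riesz–Fischer space: (P1), (P2), (P4),
(P5), the Riesz–Fischer property and monotonicity for the Hardy–Littlewood–Pólya relation. -/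
structure IsMonotoneRieszFischer (ρ : L0 → ℝ≥0∞) : Prop extends IsRINorm ρ where
  riesz_fischer : ∀ f : ℕ → L0, ∑' n, ρ (f n) < ∞ →
    ∃ g : L0, Tendsto (fun N => ρ (g - ∑ n ∈ Finset.range N, f n)) atTop (𝓝 0) ∧
      ρ g ≤ ∑' n, ρ (f n)
  hlp_mono : ∀ f g, HLP f g → ρ f ≤ ρ g

/-- The space `X = {f : ρ f < ∞}`. -/
def IsRINorm.space {ρ : L0 → ℝ≥0∞} (h : IsRINorm ρ) : Submodule ℝ L0 where
  carrier := {f | ρ f < ∞}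
  zero_mem' := by
    show ρ 0 < ∞
    rw [(h.eq_zero_iff 0).2 rfl]
    exact ENNReal.zero_lt_top
  add_mem' {f g} hf hg := lt_of_le_of_lt (h.add_le f g) (ENNReal.add_lt_top.2 ⟨hf, hg⟩)
  smul_mem' c f hf := by
    show ρ (c • f) < ∞
    rw [h.smul]
    exact ENNReal.mul_lt_top enorm_lt_top hf

/-- Passing to `f*` does not increase rearrangements. -/
lemma rearr_rearrFun_le (f : L0) (t : ℝ) : rearr (rearrFun f) t ≤ rearr f t := by
  refine le_sInf fun s hs => sInf_le ?_
  have hs' : halfLine {x | s < ‖f x‖ₑ} ≤ ENNReal.ofReal t := hs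
  show halfLine {x | s < ‖rearrFun f x‖ₑ} ≤ ENNReal.ofReal t
  have hae : rearrFun f =ᵐ[halfLine] fun t => (rearr f t).toReal := AEEqFun.coeFn_mk _ _
  have hpos : ∀ᵐ x ∂halfLine, x ∈ Ioi (0 : ℝ) := ae_restrict_mem measurableSet_Ioi
  have hsub : {x | s < ‖rearrFun f x‖ₑ} ≤ᵐ[halfLine] Ioo 0 t := by
    filter_upwards [hae, hpos] with x hx hx0 hxs
    have hxs' : s < ‖rearrFun f x‖ₑ := hxs
    rw [hx, Real.enorm_of_nonneg ENNReal.toReal_nonneg] at hxs'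
    refine ⟨hx0, lt_of_not_ge fun htx => ?_⟩
    have h1 : rearr f x ≤ s :=
      sInf_le (le_trans hs' (ENNReal.ofReal_le_ofReal htx))
    exact absurd (lt_of_lt_of_le hxs' ENNReal.ofReal_toReal_le) (not_lt.2 h1)
  calc halfLine {x | s < ‖rearrFun f x‖ₑ} ≤ halfLine (Ioo 0 t) := measure_mono_ae hsub
    _ ≤ volume (Ioo 0 t) := Measure.restrict_apply_le _ _
    _ = ENNReal.ofReal t := by simp

lemma IsRINorm.rearrFun_mem {ρ : L0 → ℝ≥0∞} (h : IsRINorm ρ) {f : L0} (hf : f ∈ h.space) :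
    rearrFun f ∈ h.space :=
  lt_of_le_of_lt (h.mono _ _ fun t _ => rearr_rearrFun_le f t) hf

/-- The rearrangement `f*` of `f ∈ X`, as an element of `X`. -/
noncomputable def IsRINorm.rearrangement {ρ : L0 → ℝ≥0∞} (h : IsRINorm ρ) (f : h.space) :
    h.space :=
  ⟨rearrFun f, h.rearrFun_mem f.2⟩

lemma halfLine_Ioo_lt_top (t : ℝ) : halfLine (Ioo 0 t) < ∞ :=
  lt_of_le_of_lt (Measure.restrict_apply_le _ _) (by simp)

/-- The function `χ_(0,t)`, as an element of `X`. -/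
noncomputable def IsRINorm.charIoo {ρ : L0 → ℝ≥0∞} (h : IsRINorm ρ) (t : ℝ) : h.space :=
  ⟨charFn (Ioo 0 t) measurableSet_Ioo, h.charFn_lt_top _ _ (halfLine_Ioo_lt_top t)⟩

/-- A linear operator `T : X → L¹ + L^∞` is of class `𝓗`. -/
structure ClassH {ρ : L0 → ℝ≥0∞} (h : IsRINorm ρ) (T : h.space →ₗ[ℝ] L1Linf) : Prop where
  /-- (i) `T` maps positive decreasing functions to positive decreasing functions. -/
  decreasing : ∀ f : h.space, IsPosDecr f → IsPosDecr (T f)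
  /-- (ii) `T f ≺ T f*`. -/
  hlp_monotone : ∀ f : h.space, HLP (T f) (T (h.rearrangement f))
  /-- (iii) `S χ_(0,t) ≤ S T χ_(0,t)`. -/
  restricted_lower : ∀ t : ℝ, 0 < t → ∀ s : ℝ, 0 < s →
    hardy (h.charIoo t) s ≤ hardy (T (h.charIoo t)) s

/-- The norm of `ℜ[T,X]₀`: the infimum of `‖g‖_X` over the `g ∈ X` with `f** ≤ (T g*)**`,
for `f ∈ L¹ + L^∞`. It is `∞` exactly when `f` is not in `ℜ[T,X]₀`. -/
noncomputable def rangeNorm {ρ : L0 → ℝ≥0∞} (h : IsRINorm ρ) (T : h.space →ₗ[ℝ] L1Linf)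
    (f : L0) : ℝ≥0∞ :=
  ⨅ (g : h.space) (_ : f ∈ L1Linf ∧
    ∀ t : ℝ, 0 < t → maxFun f t ≤ maxFun (T (h.rearrangement g)) t), ρ g

/-- `T : X → Z` is bounded, where `σ` is the norm of `Z`. -/
def BoundedInto {ρ : L0 → ℝ≥0∞} (h : IsRINorm ρ) (T : h.space →ₗ[ℝ] L1Linf)
    (σ : L0 → ℝ≥0∞) : Prop :=
  ∃ C : ℝ≥0, ∀ f : h.space, σ (T f) ≤ C * ρ f

/-- `Z ⊆ Y` with continuous inclusion, where `σ`, `τ` are the norms of `Z`, `Y`. -/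
def EmbedsInto (σ τ : L0 → ℝ≥0∞) : Prop :=
  ∃ C : ℝ≥0, ∀ f : L0, σ f < ∞ → τ f ≤ C * σ f

/-- The space with norm `σ` is the optimal range of `T` on `X` among r.i. monotone Riesz–Fischer
spaces: it is one of them, `T` is bounded from `X` into it, and it is the smallest such space. -/
structure IsOptimalMonotoneRange {ρ : L0 → ℝ≥0∞} (h : IsRINorm ρ) (T : h.space →ₗ[ℝ] L1Linf)
    (σ : L0 → ℝ≥0∞) : Prop where
  isMonotoneRieszFischer : IsMonotoneRieszFischer σ
  bounded : BoundedInto h T σ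
  optimal : ∀ τ : L0 → ℝ≥0∞, IsMonotoneRieszFischer τ → BoundedInto h T τ → EmbedsInto σ τ

end OptimalRange

/-!
Write `K f t = ∫₀ᵗ f*` (`rearrInt`), so that `f** ≤ g**` and `f ≺ g` both mean `K f ≤ K g`.
Everything about rearrangements rests on the formula
`K f t = min_s (t s + ∫ (|f| - s)₊)` (`rearrInt_le` and `exists_le_rearrInt`), a consequence of
the equimeasurability of `f` and `f*`. It gives the countable subadditivity of `K` in `f`, the
bound `∫_E |f| ≤ K f |E|`, and the description of `L¹ + L^∞` as the functions with finite `K`.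
A positive decreasing function equals its rearrangement a.e., so on such functions `K` is additive.

Since `g*` is positive decreasing, the norm of the optimal range is the infimum of `‖G‖_X` over
positive decreasing `G ∈ X` with `f ≺ T G`. Let `G = ∑ G_n` be a series of positive decreasing
functions with `∑ ‖G_n‖_X < ∞`; by the Fatou property it has a sum in
`X`, of norm at most `∑ ‖G_n‖_X`. Its remainders are again
positive decreasing, hence so are their images under `T`, and therefore
`∑ K (T G_n) ≤ K (T G)` (`ClassH.tsum_rearrInt_le`), with no continuity of `T` assumed. This
inequality is used twice. It shows that `G ↦ K (T G) t` is automatically bounded by a multiple of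
`‖G‖_X` (`ClassH.exists_rearrInt_le`), which yields the definiteness of the norm and (P5). And,
together with the subadditivity of `K`, it makes the norm countably subadditive
(`ClassH.rangeNorm_le_tsum`), which is the Riesz–Fischer property. Condition (iii) of class `𝓗`
gives (P4), condition (ii) the boundedness of `T`, and optimality is immediate: if `f ≺ T G`, then
`‖f‖_Y ≤ ‖T G‖_Y ≤ C ‖G‖_X` for any competing range `Y`.
-/

namespace OptimalRange

/-! ### Rearrangements -/

lemma halfLine_Ioo (t : ℝ) : halfLine (Ioo 0 t) = ENNReal.ofReal t := by
  rw [Measure.restrict_apply measurableSet_Ioo, inter_eq_left.2 Ioo_subset_Ioi_self,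
    Real.volume_Ioo, sub_zero]

lemma halfLine_Ioo_ne_zero {t : ℝ} (ht : 0 < t) : halfLine (Ioo 0 t) ≠ 0 := by
  rw [halfLine_Ioo]
  simpa using ht

lemma halfLine_ofReal_lt (a : ℝ≥0∞) : halfLine {u : ℝ | ENNReal.ofReal u < a} = a := by
  have hm : MeasurableSet {u : ℝ | ENNReal.ofReal u < a} :=
    measurableSet_lt ENNReal.measurable_ofReal measurable_const
  rw [Measure.restrict_apply hm]
  rcases eq_or_ne a ∞ with rfl | ha
  · simp
  · have : {u : ℝ | ENNReal.ofReal u < a} ∩ Ioi 0 = Ioo 0 a.toReal := by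
      ext u
      simp only [mem_inter_iff, mem_ofPred_eq, mem_Ioi, mem_Ioo]
      constructor
      · rintro ⟨h, h0⟩
        exact ⟨h0, (ENNReal.ofReal_lt_iff_lt_toReal h0.le ha).1 h⟩
      · rintro ⟨h0, h⟩
        exact ⟨(ENNReal.ofReal_lt_iff_lt_toReal h0.le ha).2 h, h0⟩
    rw [this, Real.volume_Ioo, sub_zero, ENNReal.ofReal_toReal ha]

/-- The layer cake formula for functions with values in `[0, ∞]`. -/
lemma lintegral_eq_lintegral_distribution {F : ℝ → ℝ≥0∞} (hF : Measurable F) :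
    ∫⁻ x, F x ∂halfLine = ∫⁻ u, halfLine {x | ENNReal.ofReal u < F x} ∂halfLine := by
  have hm : MeasurableSet {p : ℝ × ℝ | ENNReal.ofReal p.2 < F p.1} :=
    measurableSet_lt (ENNReal.measurable_ofReal.comp measurable_snd) (hF.comp measurable_fst)
  have h1 : ∀ x, F x = ∫⁻ u, {p : ℝ × ℝ | ENNReal.ofReal p.2 < F p.1}.indicator 1 (x, u)
      ∂halfLine := by
    intro x
    have : (fun u => {p : ℝ × ℝ | ENNReal.ofReal p.2 < F p.1}.indicator (1 : ℝ × ℝ → ℝ≥0∞) (x, u))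
        = {u : ℝ | ENNReal.ofReal u < F x}.indicator 1 := rfl
    rw [this, lintegral_indicator_one
      (measurableSet_lt ENNReal.measurable_ofReal measurable_const), halfLine_ofReal_lt]
  have h2 : ∀ u, halfLine {x | ENNReal.ofReal u < F x} =
      ∫⁻ x, {p : ℝ × ℝ | ENNReal.ofReal p.2 < F p.1}.indicator 1 (x, u) ∂halfLine := by
    intro u
    have : (fun x => {p : ℝ × ℝ | ENNReal.ofReal p.2 < F p.1}.indicator (1 : ℝ × ℝ → ℝ≥0∞) (x, u))
        = {x : ℝ | ENNReal.ofReal u < F x}.indicator 1 := rfl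
    rw [this, lintegral_indicator_one (measurableSet_lt measurable_const hF)]
  simp_rw [h2]
  rw [lintegral_congr h1]
  exact lintegral_lintegral_swap ((measurable_one.indicator hm).aemeasurable)

lemma lintegral_tsub_congr_of_distribution {F H : ℝ → ℝ≥0∞} (hF : Measurable F)
    (hH : Measurable H) (h : ∀ s, halfLine {x | s < F x} = halfLine {x | s < H x}) (s : ℝ≥0∞) :
    ∫⁻ x, (F x - s) ∂halfLine = ∫⁻ x, (H x - s) ∂halfLine := by
  rw [lintegral_eq_lintegral_distribution (hF.sub_const s),
    lintegral_eq_lintegral_distribution (hH.sub_const s)]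
  simp only [lt_tsub_iff_left, h]

lemma measurable_enorm_coe (f : L0) : Measurable fun x => ‖f x‖ₑ :=
  f.measurable.enorm

/-- The infimum defining `f*` is attained. -/
lemma lt_rearr_iff (f : L0) (s : ℝ≥0∞) (t : ℝ) :
    s < rearr f t ↔ ENNReal.ofReal t < halfLine {x | s < ‖f x‖ₑ} := by
  rw [← not_le, ← not_le, not_iff_not]
  refine ⟨fun h => ?_, fun h => sInf_le h⟩
  rcases eq_or_ne s ∞ with rfl | hs
  · simp
  obtain ⟨u, hu, hus, hlim⟩ := exists_seq_strictAnti_tendsto' (lt_top_iff_ne_top.2 hs)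
  have hset : {x | s < ‖f x‖ₑ} = ⋃ n, {x | u n < ‖f x‖ₑ} := by
    ext x
    simp only [mem_ofPred_eq, mem_iUnion]
    exact ⟨fun hx => (hlim.eventually_lt_const hx).exists, fun ⟨n, hn⟩ => (hus n).1.trans hn⟩
  have hmono : Monotone fun n => {x | u n < ‖f x‖ₑ} := fun m n hmn x hx =>
    lt_of_le_of_lt (hu.antitone hmn) hx
  rw [hset, hmono.measure_iUnion]
  refine iSup_le fun n => ?_
  obtain ⟨v, hv, hvn⟩ := sInf_lt_iff.1 (lt_of_le_of_lt h (hus n).1)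
  exact le_trans (measure_mono fun x hx => lt_trans hvn hx) hv

lemma halfLine_lt_rearr (f : L0) (s : ℝ≥0∞) :
    halfLine {x | s < rearr f x} = halfLine {x | s < ‖f x‖ₑ} := by
  simp only [lt_rearr_iff]
  exact halfLine_ofReal_lt _

lemma lintegral_rearr_tsub (f : L0) (s : ℝ≥0∞) :
    ∫⁻ x, (rearr f x - s) ∂halfLine = ∫⁻ x, (‖f x‖ₑ - s) ∂halfLine :=
  lintegral_tsub_congr_of_distribution (rearr_antitone f).measurable (measurable_enorm_coe f)
    (halfLine_lt_rearr f) s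

/-! ### The integral of the rearrangement as a `K`-functional -/

/-- The function `t ↦ ∫₀ᵗ f*`, which is the `K`-functional of `f` for the couple
`(L¹, L^∞)`. -/
noncomputable def rearrInt (f : L0) (t : ℝ) : ℝ≥0∞ := ∫⁻ s in Ioo 0 t, rearr f s

lemma volume_restrict_Ioo (t : ℝ) :
    (volume : Measure ℝ).restrict (Ioo 0 t) = halfLine.restrict (Ioo 0 t) := by
  rw [Measure.restrict_restrict measurableSet_Ioo,
    inter_eq_left.2 (Ioo_subset_Ioi_self)]

lemma rearrInt_le (f : L0) (t : ℝ) (s : ℝ≥0∞) :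
    rearrInt f t ≤ ENNReal.ofReal t * s + ∫⁻ x, (‖f x‖ₑ - s) ∂halfLine := by
  calc rearrInt f t ≤ ∫⁻ x in Ioo 0 t, (s + (rearr f x - s)) :=
        lintegral_mono fun x => le_add_tsub
    _ = ENNReal.ofReal t * s + ∫⁻ x in Ioo 0 t, (rearr f x - s) := by
        rw [lintegral_add_left measurable_const]
        simp [mul_comm]
    _ ≤ ENNReal.ofReal t * s + ∫⁻ x, (rearr f x - s) ∂halfLine := by
        gcongr
        rw [volume_restrict_Ioo]
        exact Measure.restrict_le_self
    _ = _ := by rw [lintegral_rearr_tsub]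

/-- The bound of `rearrInt_le` is attained, at the level `s = f*(t)`. -/
lemma exists_le_rearrInt (f : L0) (t : ℝ) :
    ∃ s : ℝ≥0∞, ENNReal.ofReal t * s + ∫⁻ x, (‖f x‖ₑ - s) ∂halfLine ≤ rearrInt f t := by
  refine ⟨rearr f t, ?_⟩
  have h1 : ∫⁻ x, (rearr f x - rearr f t) ∂halfLine
      ≤ ∫⁻ x in Ioo 0 t, (rearr f x - rearr f t) := by
    rw [volume_restrict_Ioo, ← lintegral_indicator measurableSet_Ioo]
    refine lintegral_mono_ae ?_
    filter_upwards [ae_restrict_mem measurableSet_Ioi] with x hx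
    by_cases hxt : x < t
    · rw [indicator_of_mem (show x ∈ Ioo 0 t from ⟨hx, hxt⟩)]
    · rw [tsub_eq_zero_of_le (rearr_antitone f (not_lt.1 hxt))]
      exact zero_le
  rw [← lintegral_rearr_tsub]
  calc ENNReal.ofReal t * rearr f t + ∫⁻ x, (rearr f x - rearr f t) ∂halfLine
      ≤ (∫⁻ _ in Ioo 0 t, rearr f t) + ∫⁻ x in Ioo 0 t, (rearr f x - rearr f t) := by
        gcongr
        simp [mul_comm]
    _ = ∫⁻ x in Ioo 0 t, (rearr f t + (rearr f x - rearr f t)) :=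
        (lintegral_add_left measurable_const _).symm
    _ = rearrInt f t := setLIntegral_congr_fun measurableSet_Ioo fun x hx =>
        add_tsub_cancel_of_le (rearr_antitone f hx.2.le)

lemma rearrInt_le_tsum {ι : Type*} [Countable ι] {F : L0} {f : ι → L0}
    (h : ∀ᵐ x ∂halfLine, ‖F x‖ₑ ≤ ∑' i, ‖f i x‖ₑ) (t : ℝ) :
    rearrInt F t ≤ ∑' i, rearrInt (f i) t := by
  choose s hs using fun i => exists_le_rearrInt (f i) t
  calc rearrInt F t ≤ ENNReal.ofReal t * ∑' i, s i + ∫⁻ x, (‖F x‖ₑ - ∑' i, s i) ∂halfLine :=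
        rearrInt_le F t _
    _ ≤ ENNReal.ofReal t * ∑' i, s i + ∫⁻ x, ∑' i, (‖f i x‖ₑ - s i) ∂halfLine := by
        gcongr 1
        refine lintegral_mono_ae ?_
        filter_upwards [h] with x hx
        rw [tsub_le_iff_right, ← ENNReal.tsum_add]
        exact hx.trans (ENNReal.tsum_le_tsum fun i => le_tsub_add)
    _ = ∑' i, (ENNReal.ofReal t * s i + ∫⁻ x, (‖f i x‖ₑ - s i) ∂halfLine) := by
        rw [lintegral_tsum fun i => ((measurable_enorm_coe (f i)).sub_const _).aemeasurable,
          ENNReal.tsum_add, ENNReal.tsum_mul_left]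
    _ ≤ _ := ENNReal.tsum_le_tsum hs

lemma rearrInt_add_le (f g : L0) (t : ℝ) :
    rearrInt (f + g) t ≤ rearrInt f t + rearrInt g t := by
  have h := rearrInt_le_tsum (F := f + g) (f := fun b : Bool => if b then f else g) ?_ t
  · simpa [tsum_fintype] using h
  · filter_upwards [AEEqFun.coeFn_add f g] with x hx
    simpa [tsum_fintype, hx] using enorm_add_le (f x) (g x)

lemma rearrInt_smul_le (c : ℝ) (f : L0) (t : ℝ) :
    rearrInt (c • f) t ≤ ‖c‖ₑ * rearrInt f t := by
  obtain ⟨s, hs⟩ := exists_le_rearrInt f t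
  calc rearrInt (c • f) t
      ≤ ENNReal.ofReal t * (‖c‖ₑ * s) + ∫⁻ x, (‖(c • f : L0) x‖ₑ - ‖c‖ₑ * s) ∂halfLine :=
        rearrInt_le _ _ _
    _ = ‖c‖ₑ * (ENNReal.ofReal t * s + ∫⁻ x, (‖f x‖ₑ - s) ∂halfLine) := by
        rw [mul_add, ← lintegral_const_mul _ ((measurable_enorm_coe f).sub_const _)]
        congr 1
        · ring
        · refine lintegral_congr_ae ?_
          filter_upwards [AEEqFun.coeFn_smul c f] with x hx
          rw [hx, ENNReal.mul_sub fun _ _ => enorm_ne_top]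
          simp [enorm_mul]
    _ ≤ _ := by gcongr

lemma rearrInt_zero (t : ℝ) : rearrInt 0 t = 0 := by
  simpa using rearrInt_smul_le 0 (0 : L0) t

lemma rearrInt_smul (c : ℝ) (f : L0) (t : ℝ) :
    rearrInt (c • f) t = ‖c‖ₑ * rearrInt f t := by
  refine le_antisymm (rearrInt_smul_le c f t) ?_
  rcases eq_or_ne c 0 with rfl | hc
  · simp
  · have h := rearrInt_smul_le c⁻¹ (c • f) t
    rw [smul_smul, inv_mul_cancel₀ hc, one_smul] at h
    calc ‖c‖ₑ * rearrInt f t ≤ ‖c‖ₑ * (‖c⁻¹‖ₑ * rearrInt (c • f) t) := by gcongr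
      _ = _ := by rw [← mul_assoc, ← enorm_mul, mul_inv_cancel₀ hc, enorm_one, one_mul]

/-- The Hardy–Littlewood inequality for characteristic functions. -/
lemma setLIntegral_le_rearrInt (f : L0) {E : Set ℝ} {t : ℝ}
    (hE : halfLine E ≤ ENNReal.ofReal t) : ∫⁻ x in E, ‖f x‖ₑ ∂halfLine ≤ rearrInt f t := by
  obtain ⟨s, hs⟩ := exists_le_rearrInt f t
  refine le_trans ?_ hs
  calc ∫⁻ x in E, ‖f x‖ₑ ∂halfLine ≤ ∫⁻ x in E, (s + (‖f x‖ₑ - s)) ∂halfLine :=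
        lintegral_mono fun x => le_add_tsub
    _ = s * halfLine E + ∫⁻ x in E, (‖f x‖ₑ - s) ∂halfLine := by
        rw [lintegral_add_left measurable_const, setLIntegral_const]
    _ ≤ ENNReal.ofReal t * s + ∫⁻ x, (‖f x‖ₑ - s) ∂halfLine := by
        rw [mul_comm]
        gcongr
        exact Measure.restrict_le_self

lemma rearrInt_lt_top_of_mem {f : L0} (hf : f ∈ L1Linf) (t : ℝ) :
    rearrInt f t < ∞ := by
  obtain ⟨a, ha, b, hb, rfl⟩ := Submodule.mem_sup.1 hf
  have ha' : eLpNorm a 1 halfLine < ∞ := ha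
  have hb' : eLpNorm b ∞ halfLine < ∞ := hb
  rw [eLpNorm_one_eq_lintegral_enorm] at ha'
  rw [eLpNorm_exponent_top] at hb'
  refine lt_of_le_of_lt (rearrInt_add_le a b t) (ENNReal.add_lt_top.2 ⟨?_, ?_⟩)
  · refine lt_of_le_of_lt (rearrInt_le a t 0) ?_
    simpa using ha'
  · refine lt_of_le_of_lt (rearrInt_le b t (eLpNormEssSup b halfLine)) ?_
    have : ∫⁻ x, (‖b x‖ₑ - eLpNormEssSup b halfLine) ∂halfLine = 0 := by
      rw [lintegral_eq_zero_iff ((measurable_enorm_coe b).sub_const _)]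
      filter_upwards [enorm_ae_le_eLpNormEssSup b halfLine] with x hx
      exact tsub_eq_zero_of_le hx
    rw [this, add_zero]
    exact ENNReal.mul_lt_top ENNReal.ofReal_lt_top hb'

lemma enorm_sub_truncation_le (y : ℝ) (s : ℝ≥0) :
    ‖y - max (-(s : ℝ)) (min y s)‖ₑ ≤ ‖y‖ₑ - (s : ℝ≥0∞) := by
  have hs : (0 : ℝ) ≤ s := s.2
  rw [← ofReal_norm, ← ofReal_norm, ← ENNReal.ofReal_coe_nnreal,
    ← ENNReal.ofReal_sub _ hs, Real.norm_eq_abs, Real.norm_eq_abs]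
  by_cases h1 : (s : ℝ) < y
  · rw [min_eq_right h1.le, max_eq_right (by linarith), abs_of_pos (by linarith),
      abs_of_pos (by linarith)]
  · rw [min_eq_left (not_lt.1 h1)]
    by_cases h2 : y < -s
    · rw [max_eq_left h2.le, abs_of_neg (by linarith), abs_of_neg (by linarith)]
      exact ENNReal.ofReal_le_ofReal (by linarith)
    · rw [max_eq_right (not_lt.1 h2)]
      simp

/-- A function is in `L¹ + L^∞` as soon as its `K`-functional is finite at one point: it splits
into its truncation at the minimizing level and the remainder. -/
lemma mem_L1Linf_of_rearrInt_lt_top {f : L0} {t : ℝ} (ht : 0 < t) (h : rearrInt f t < ∞) :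
    f ∈ L1Linf := by
  obtain ⟨s, hs⟩ := exists_le_rearrInt f t
  have hs' := lt_of_le_of_lt hs h
  rw [ENNReal.add_lt_top] at hs'
  have hsfin : s ≠ ∞ := by
    rintro rfl
    rw [ENNReal.mul_top (by simpa using ht)] at hs'
    exact lt_irrefl _ hs'.1
  lift s to ℝ≥0 using hsfin
  have hbm : Measurable fun x => max (-(s : ℝ)) (min (f x) s) :=
    measurable_const.max (f.measurable.min measurable_const)
  set b : L0 := AEEqFun.mk (fun x => max (-(s : ℝ)) (min (f x) s)) hbm.aestronglyMeasurable
    with hb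
  have hbx : b =ᵐ[halfLine] fun x => max (-(s : ℝ)) (min (f x) s) := AEEqFun.coeFn_mk _ _
  have h1 : f - b ∈ Lp.LpSubmodule ℝ ℝ 1 halfLine := by
    show eLpNorm (f - b : L0) 1 halfLine < ∞
    rw [eLpNorm_one_eq_lintegral_enorm]
    refine lt_of_le_of_lt (lintegral_mono_ae ?_) hs'.2
    filter_upwards [AEEqFun.coeFn_sub f b, hbx] with x hx hx'
    rw [hx, Pi.sub_apply, hx']
    exact enorm_sub_truncation_le _ _
  have h2 : b ∈ Lp.LpSubmodule ℝ ℝ ∞ halfLine := by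
    show eLpNorm b ∞ halfLine < ∞
    refine (memLp_top_of_bound b.aestronglyMeasurable (s : ℝ) ?_).2
    filter_upwards [hbx] with x hx
    rw [hx, Real.norm_eq_abs, abs_le]
    exact ⟨le_max_left _ _, max_le (by linarith [s.2]) (min_le_right _ _)⟩
  have hsum := Submodule.add_mem_sup h1 h2
  rwa [sub_add_cancel] at hsum

lemma HLP.mem_L1Linf {f g : L0} (h : HLP f g) (hg : g ∈ L1Linf) : f ∈ L1Linf :=
  mem_L1Linf_of_rearrInt_lt_top one_pos
    (lt_of_le_of_lt (h 1 one_pos) (rearrInt_lt_top_of_mem hg 1))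

lemma maxFun_le_maxFun_iff (f g : L0) :
    (∀ t : ℝ, 0 < t → maxFun f t ≤ maxFun g t) ↔ HLP f g := by
  refine forall_congr' fun t => forall_congr' fun ht => ?_
  exact ENNReal.mul_le_mul_iff_right (by simp) (by simpa using ht)

/-! ### Positive decreasing functions -/

lemma IsPosDecr.zero : IsPosDecr 0 :=
  ⟨fun _ => 0, fun _ _ _ _ _ => le_rfl, fun _ _ => le_rfl, AEEqFun.coeFn_zero⟩

lemma IsPosDecr.add {f g : L0} (hf : IsPosDecr f) (hg : IsPosDecr g) : IsPosDecr (f + g) := by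
  obtain ⟨φ, h1, h2, h3⟩ := hf
  obtain ⟨ψ, h4, h5, h6⟩ := hg
  refine ⟨fun t => φ t + ψ t, h1.add h4, fun t ht => add_nonneg (h2 t ht) (h5 t ht), ?_⟩
  exact (AEEqFun.coeFn_add f g).trans (h3.add h6)

lemma IsPosDecr.smul {f : L0} (hf : IsPosDecr f) {c : ℝ} (hc : 0 ≤ c) : IsPosDecr (c • f) := by
  obtain ⟨φ, h1, h2, h3⟩ := hf
  refine ⟨fun t => c * φ t, fun a ha b hb hab => mul_le_mul_of_nonneg_left (h1 ha hb hab) hc,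
    fun t ht => mul_nonneg hc (h2 t ht), ?_⟩
  filter_upwards [AEEqFun.coeFn_smul c f, h3] with x hx hx'
  simp [hx, hx']

lemma IsPosDecr.nonneg {f : L0} (hf : IsPosDecr f) : ∀ᵐ x ∂halfLine, 0 ≤ f x := by
  obtain ⟨φ, h1, h2, h3⟩ := hf
  filter_upwards [h3, ae_restrict_mem measurableSet_Ioi] with x hx hx0
  rw [hx]
  exact h2 x hx0

lemma isPosDecr_rearrFun {f : L0} (hf : ∀ t, 0 < t → rearr f t ≠ ∞) : IsPosDecr (rearrFun f) :=
  ⟨fun t => (rearr f t).toReal,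
    fun _ ha _ _ hab => ENNReal.toReal_mono (hf _ ha) (rearr_antitone f hab),
    fun _ _ => ENNReal.toReal_nonneg, AEEqFun.coeFn_mk _ _⟩

/-- A positive decreasing function agrees with its rearrangement wherever it is continuous, so
almost everywhere. -/
lemma IsPosDecr.rearr_ae_eq {f : L0} (hf : IsPosDecr f) :
    rearr f =ᵐ[halfLine] fun x => ‖f x‖ₑ := by
  obtain ⟨φ, hφ, hφ0, hfφ⟩ := hf
  have hdist : ∀ s : ℝ≥0∞, halfLine {x | s < ‖f x‖ₑ}
      = halfLine {x | s < ENNReal.ofReal (φ x)} := by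
    intro s
    refine measure_congr ?_
    filter_upwards [hfφ, ae_restrict_mem measurableSet_Ioi] with x hx hx0
    show (s < ‖f x‖ₑ) = (s < ENNReal.ofReal (φ x))
    rw [hx, Real.enorm_of_nonneg (hφ0 x hx0)]
  have hcont : ∀ᵐ t ∂halfLine, ContinuousWithinAt φ (Ioi 0) t := by
    have hc := (hφ.countable_not_continuousWithinAt).ae_notMem halfLine
    filter_upwards [hc, ae_restrict_mem measurableSet_Ioi] with t ht ht0
    by_contra hcon
    exact ht ⟨ht0, hcon⟩
  filter_upwards [hfφ, hcont, ae_restrict_mem measurableSet_Ioi] with t ht htc ht0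
  have ht0' : (0 : ℝ) < t := ht0
  rw [ht, Real.enorm_of_nonneg (hφ0 t ht0)]
  refine le_antisymm (sInf_le ?_) (le_sInf fun s hs => ?_)
  · show halfLine _ ≤ _
    rw [hdist]
    calc halfLine {x | ENNReal.ofReal (φ t) < ENNReal.ofReal (φ x)}
        ≤ halfLine {x | ENNReal.ofReal x < ENNReal.ofReal t} := by
          refine measure_mono_ae ?_
          filter_upwards [ae_restrict_mem measurableSet_Ioi] with x hx hlt
          refine (ENNReal.ofReal_lt_ofReal_iff ht0').2 (lt_of_not_ge fun hxt => ?_)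
          exact absurd hlt (not_lt.2 (ENNReal.ofReal_le_ofReal (hφ ht0 hx hxt)))
      _ = ENNReal.ofReal t := halfLine_ofReal_lt _
  · have hs' : halfLine {x | s < ‖f x‖ₑ} ≤ ENNReal.ofReal t := hs
    rw [hdist] at hs'
    have hlim : Tendsto (fun x => ENNReal.ofReal (φ x)) (𝓝[>] t) (𝓝 (ENNReal.ofReal (φ t))) :=
      (ENNReal.continuous_ofReal.tendsto _).comp
        (htc.mono_left (nhdsWithin_mono _ (Ioi_subset_Ioi ht0'.le)))
    refine le_of_tendsto hlim ?_
    filter_upwards [self_mem_nhdsWithin] with v hv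
    have hv' : t < v := hv
    by_contra hcon
    have hle : ENNReal.ofReal v ≤ ENNReal.ofReal t := by
      calc ENNReal.ofReal v = halfLine {x | ENNReal.ofReal x < ENNReal.ofReal v} :=
            (halfLine_ofReal_lt _).symm
        _ ≤ halfLine {x | s < ENNReal.ofReal (φ x)} := by
            refine measure_mono_ae ?_
            filter_upwards [ae_restrict_mem measurableSet_Ioi] with x hx hlt
            have hxv : x < v := (ENNReal.ofReal_lt_ofReal_iff (ht0'.trans hv')).1 hlt
            exact lt_of_lt_of_le (not_le.1 hcon)
              (ENNReal.ofReal_le_ofReal (hφ hx (ht0'.trans hv') hxv.le))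
        _ ≤ _ := hs'
    exact absurd hle (not_le.2 ((ENNReal.ofReal_lt_ofReal_iff (ht0'.trans hv')).2 hv'))

lemma IsPosDecr.rearrFun_eq {f : L0} (hf : IsPosDecr f) : rearrFun f = f := by
  refine AEEqFun.ext ((AEEqFun.coeFn_mk _ _).trans ?_)
  filter_upwards [hf.rearr_ae_eq, hf.nonneg] with x hx hx0
  rw [hx, Real.enorm_of_nonneg hx0, ENNReal.toReal_ofReal hx0]

lemma IsPosDecr.rearrInt_eq {f : L0} (hf : IsPosDecr f) (t : ℝ) :
    rearrInt f t = ∫⁻ x in Ioo 0 t, ‖f x‖ₑ ∂halfLine := by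
  rw [rearrInt, volume_restrict_Ioo]
  exact lintegral_congr_ae (ae_restrict_of_ae hf.rearr_ae_eq)

lemma IsPosDecr.rearrInt_add {f g : L0} (hf : IsPosDecr f) (hg : IsPosDecr g) (t : ℝ) :
    rearrInt (f + g) t = rearrInt f t + rearrInt g t := by
  rw [hf.rearrInt_eq, hg.rearrInt_eq, (hf.add hg).rearrInt_eq,
    ← lintegral_add_left (measurable_enorm_coe f)]
  refine lintegral_congr_ae (ae_restrict_of_ae ?_)
  filter_upwards [hf.nonneg, hg.nonneg, AEEqFun.coeFn_add f g] with x h1 h2 h3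
  rw [h3, Pi.add_apply, Real.enorm_of_nonneg h1, Real.enorm_of_nonneg h2,
    Real.enorm_of_nonneg (add_nonneg h1 h2), ENNReal.ofReal_add h1 h2]

/-! ### Pointwise sums of sequences -/

lemma ae_tsum_enorm_lt_top {f : ℕ → L0}
    (h : ∀ k : ℕ, ∑' n, ∫⁻ x in Ioo 0 (k : ℝ), ‖f n x‖ₑ ∂halfLine < ∞) :
    ∀ᵐ x ∂halfLine, ∑' n, ‖f n x‖ₑ < ∞ := by
  have hk : ∀ k : ℕ, ∀ᵐ x ∂halfLine, x ∈ Ioo 0 (k : ℝ) → ∑' n, ‖f n x‖ₑ < ∞ := by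
    intro k
    refine (ae_restrict_iff' measurableSet_Ioo).1 (ae_lt_top
      (Measurable.tsum fun n => measurable_enorm_coe (f n)) ?_)
    rw [lintegral_tsum fun n => (measurable_enorm_coe (f n)).aemeasurable]
    exact (h k).ne
  filter_upwards [ae_all_iff.2 hk, ae_restrict_mem measurableSet_Ioi] with x hx hx0
  obtain ⟨k, hxk⟩ := exists_nat_gt x
  exact hx k ⟨hx0, hxk⟩

lemma exists_hasSum_ae {f : ℕ → L0} (h : ∀ᵐ x ∂halfLine, ∑' n, ‖f n x‖ₑ < ∞) :
    ∃ F : L0, ∀ᵐ x ∂halfLine, HasSum (fun n => f n x) (F x) := by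
  have hs : ∀ᵐ x ∂halfLine, HasSum (fun n => f n x) (∑' n, f n x) := by
    filter_upwards [h] with x hx
    refine Summable.hasSum (Summable.of_norm ?_)
    refine (ENNReal.summable_toReal hx.ne).congr fun n => ?_
    simp
  have hm : AEStronglyMeasurable (fun x => ∑' n, f n x) halfLine := by
    refine aestronglyMeasurable_of_tendsto_ae atTop
      (f := fun N x => ∑ n ∈ Finset.range N, f n x)
      (fun N => (Finset.measurable_sum _ fun n _ => (f n).measurable).aestronglyMeasurable) ?_
    filter_upwards [hs] with x hx
    exact hx.tendsto_sum_nat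
  refine ⟨AEEqFun.mk _ hm, ?_⟩
  filter_upwards [hs, AEEqFun.coeFn_mk _ hm] with x hx hx'
  rwa [hx']

lemma coeFn_sum_range (f : ℕ → L0) (N : ℕ) :
    (∑ n ∈ Finset.range N, f n : L0) =ᵐ[halfLine] fun x => ∑ n ∈ Finset.range N, f n x := by
  induction N with
  | zero =>
    simp only [Finset.range_zero, Finset.sum_empty]
    exact AEEqFun.coeFn_zero
  | succ N ih =>
    simp only [Finset.sum_range_succ]
    exact (AEEqFun.coeFn_add _ _).trans (ih.add EventuallyEq.rfl)

/-- The tails of a series of positive decreasing functions are positive decreasing. -/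
lemma isPosDecr_sub_sum {f : ℕ → L0} (hf : ∀ n, IsPosDecr (f n)) {F : L0}
    (hF : ∀ᵐ x ∂halfLine, HasSum (fun n => f n x) (F x)) (N : ℕ) :
    IsPosDecr (F - ∑ n ∈ Finset.range N, f n) := by
  choose φ hφ hφ0 hfφ using hf
  have hae : ∀ᵐ x ∂halfLine, HasSum (fun n => φ n x) (F x) := by
    filter_upwards [hF, ae_all_iff.2 hfφ] with x hx hx'
    simpa only [hx'] using hx
  -- summability at one point `u < t` gives summability at `t`, by monotonicity
  have hsum : ∀ t, 0 < t → Summable fun n => φ n t := by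
    intro t ht
    obtain ⟨u, hu, hus⟩ :=
      ((frequently_ae_mem_iff.2 (halfLine_Ioo_ne_zero ht)).and_eventually hae).exists
    exact hus.summable.of_nonneg_of_le (fun n => hφ0 n t ht)
      fun n => hφ n hu.1 ht hu.2.le
  refine ⟨fun t => ∑' n, φ (n + N) t, fun a ha b hb hab => ?_, fun t ht =>
    tsum_nonneg fun n => hφ0 _ t ht, ?_⟩
  · exact Summable.tsum_le_tsum (fun n => hφ _ ha hb hab)
      ((summable_nat_add_iff N).2 (hsum b hb)) ((summable_nat_add_iff N).2 (hsum a ha))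
  · filter_upwards [hae, ae_all_iff.2 hfφ, AEEqFun.coeFn_sub F (∑ n ∈ Finset.range N, f n),
      coeFn_sum_range f N] with x hx hx1 hx2 hx3
    rw [hx2, Pi.sub_apply, hx3, ← hx.tsum_eq, ← hx.summable.sum_add_tsum_nat_add N]
    simp only [hx1]
    ring


/-! ### Positive decreasing functions in an r.i. space -/

variable {ρ : L0 → ℝ≥0∞}

lemma coeFn_charFn {E : Set ℝ} (hE : MeasurableSet E) :
    charFn E hE =ᵐ[halfLine] E.indicator fun _ => (1 : ℝ) :=
  AEEqFun.coeFn_mk _ _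

lemma charFn_ne_zero {E : Set ℝ} (hE : MeasurableSet E) (h : halfLine E ≠ 0) :
    charFn E hE ≠ 0 := by
  intro h0
  obtain ⟨x, hx, hx1, hx2⟩ := ((frequently_ae_mem_iff.2 h).and_eventually
    ((coeFn_charFn hE).and (AEEqFun.coeFn_zero : ⇑(0 : L0) =ᵐ[halfLine] 0))).exists
  have hx3 : (charFn E hE : L0) x = 1 := by
    rw [hx1, indicator_of_mem hx]
  rw [h0, hx2] at hx3
  simp at hx3

/-- The rearrangement of a function in `X` is finite: if `f*(t) = ∞`, then `f*` dominates all
multiples of `χ_(0,t)`. -/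
lemma IsRINorm.rearr_ne_top (h : IsRINorm ρ) {f : L0} (hf : ρ f < ∞) {t : ℝ} (ht : 0 < t) :
    rearr f t ≠ ∞ := by
  intro htop
  set χ : L0 := charFn (Ioo 0 t) measurableSet_Ioo with hχ
  have hχ0 : ρ χ ≠ 0 := fun h0 =>
    charFn_ne_zero measurableSet_Ioo (halfLine_Ioo_ne_zero ht) ((h.eq_zero_iff _).1 h0)
  have hle : ∀ n : ℕ, (n : ℝ≥0∞) * ρ χ ≤ ρ f := by
    intro n
    have hn : ‖(n : ℝ)‖ₑ = n := by simp
    rw [← hn, ← h.smul]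
    refine h.mono _ _ fun u hu => ?_
    rcases le_total u t with hut | htu
    · exact le_trans le_top (htop ▸ rearr_antitone f hut)
    · refine le_trans (sInf_le ?_) zero_le
      show halfLine {x | 0 < ‖((n : ℝ) • χ : L0) x‖ₑ} ≤ ENNReal.ofReal u
      calc halfLine {x | 0 < ‖((n : ℝ) • χ : L0) x‖ₑ} ≤ halfLine (Ioo 0 t) := by
            refine measure_mono_ae ?_
            filter_upwards [AEEqFun.coeFn_smul (n : ℝ) χ,
              coeFn_charFn (measurableSet_Ioo (a := 0) (b := t))] with x hx1 hx2 hx3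
            have hx3' : 0 < ‖((n : ℝ) • χ : L0) x‖ₑ := hx3
            by_contra hx4
            rw [hx1, Pi.smul_apply, hχ, hx2, indicator_of_notMem (s := Ioo 0 t) hx4] at hx3'
            simp at hx3'
        _ = ENNReal.ofReal t := halfLine_Ioo t
        _ ≤ ENNReal.ofReal u := ENNReal.ofReal_le_ofReal htu
  obtain ⟨n, hn⟩ := ENNReal.exists_nat_mul_gt hχ0 hf.ne
  exact absurd (hle n) (not_le.2 hn)

lemma IsRINorm.isPosDecr_rearrangement (h : IsRINorm ρ) (f : h.space) :
    IsPosDecr (h.rearrangement f : L0) :=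
  isPosDecr_rearrFun fun _ ht => h.rearr_ne_top f.2 ht

lemma IsRINorm.rearrangement_eq (h : IsRINorm ρ) {f : h.space} (hf : IsPosDecr (f : L0)) :
    h.rearrangement f = f :=
  Subtype.ext hf.rearrFun_eq

lemma IsRINorm.norm_rearrangement_le (h : IsRINorm ρ) (f : h.space) :
    ρ (h.rearrangement f) ≤ ρ f :=
  h.mono _ _ fun t _ => rearr_rearrFun_le f t

lemma isPosDecr_sum {G : ℕ → L0} (hG : ∀ n, IsPosDecr (G n)) (N : ℕ) :
    IsPosDecr (∑ n ∈ Finset.range N, G n) := by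
  induction N with
  | zero => simpa using IsPosDecr.zero
  | succ N ih =>
    rw [Finset.sum_range_succ]
    exact ih.add (hG N)

/-- The Fatou property sums series of positive decreasing functions in `X`. -/
lemma IsRISpace.exists_sum (hX : IsRISpace ρ) {G : ℕ → L0} (hG : ∀ n, IsPosDecr (G n))
    (hsum : ∑' n, ρ (G n) < ∞) :
    ∃ F : L0, ρ F ≤ ∑' n, ρ (G n) ∧ ∀ N, IsPosDecr (F - ∑ n ∈ Finset.range N, G n) := by
  have hae : ∀ᵐ x ∂halfLine, ∑' n, ‖G n x‖ₑ < ∞ := by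
    refine ae_tsum_enorm_lt_top fun k => ?_
    obtain ⟨C, hC⟩ := hX.setLIntegral_le (Ioo 0 (k : ℝ)) measurableSet_Ioo (halfLine_Ioo_lt_top k)
    refine lt_of_le_of_lt (ENNReal.tsum_le_tsum fun n => hC (G n)) ?_
    rw [ENNReal.tsum_mul_left]
    exact ENNReal.mul_lt_top ENNReal.coe_lt_top hsum
  obtain ⟨F, hF⟩ := exists_hasSum_ae hae
  refine ⟨F, ?_, isPosDecr_sub_sum hG hF⟩
  have hnorm : ∀ N, ρ (∑ n ∈ Finset.range N, G n) ≤ ∑' n, ρ (G n) := by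
    intro N
    refine le_trans ?_ (ENNReal.sum_le_tsum (Finset.range N))
    induction N with
    | zero => simp [(hX.eq_zero_iff 0).2 rfl]
    | succ N ih =>
      rw [Finset.sum_range_succ, Finset.sum_range_succ]
      exact (hX.add_le _ _).trans (by gcongr)
  refine le_of_tendsto' (hX.fatou (fun N => ∑ n ∈ Finset.range N, G n) F ?_ ?_ ?_) hnorm
  · intro N
    rw [← AEEqFun.coeFn_le]
    filter_upwards [(isPosDecr_sum hG N).nonneg,
      (AEEqFun.coeFn_zero : ⇑(0 : L0) =ᵐ[halfLine] 0)] with x hx hx'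
    rwa [hx']
  · refine monotone_nat_of_le_succ fun N => ?_
    rw [Finset.sum_range_succ, ← AEEqFun.coeFn_le]
    filter_upwards [(hG N).nonneg, AEEqFun.coeFn_add (∑ n ∈ Finset.range N, G n) (G N)]
      with x hx hx'
    rw [hx']
    exact le_add_of_nonneg_right hx
  · filter_upwards [hF, ae_all_iff.2 (coeFn_sum_range G)] with x hx hx'
    simpa only [hx'] using hx.tendsto_sum_nat

/-! ### Operators of class `𝓗` -/

variable {h : IsRINorm ρ} {T : h.space →ₗ[ℝ] L1Linf}

/-- A linear operator preserving positive decreasing functions is countably superadditive for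
`∫₀ᵗ (T ·)*`, because the remainders of the series are positive decreasing too. -/
lemma ClassH.tsum_rearrInt_le (hT : ClassH h T) {G : ℕ → h.space} (hG : ∀ n, IsPosDecr (G n : L0))
    {F : h.space} (hF : ∀ N, IsPosDecr ((F : L0) - ∑ n ∈ Finset.range N, (G n : L0))) (t : ℝ) :
    ∑' n, rearrInt (T (G n)) t ≤ rearrInt (T F) t := by
  have hsub : ∀ N, IsPosDecr ((F - ∑ n ∈ Finset.range N, G n : h.space) : L0) := by
    intro N
    simpa using hF N
  have hsumdec : ∀ N, IsPosDecr ((∑ n ∈ Finset.range N, G n : h.space) : L0) := by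
    intro N
    simpa using isPosDecr_sum hG N
  have hfin : ∀ N, rearrInt (T (∑ n ∈ Finset.range N, G n)) t
      = ∑ n ∈ Finset.range N, rearrInt (T (G n)) t := by
    intro N
    induction N with
    | zero =>
      simp only [Finset.range_zero, Finset.sum_empty, map_zero]
      exact rearrInt_zero t
    | succ N ih =>
      rw [Finset.sum_range_succ, Finset.sum_range_succ, map_add, Submodule.coe_add,
        (hT.decreasing _ (hsumdec N)).rearrInt_add (hT.decreasing _ (hG N)), ih]
  refine ENNReal.tsum_le_of_sum_range_le fun N => ?_
  have hdecomp : (T F : L0) = T (∑ n ∈ Finset.range N, G n)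
      + T (F - ∑ n ∈ Finset.range N, G n) := by
    rw [← Submodule.coe_add, ← map_add, add_sub_cancel]
  rw [hdecomp, (hT.decreasing _ (hsumdec N)).rearrInt_add (hT.decreasing _ (hsub N)), hfin]
  exact le_self_add

/-- Boundedness of `T` on positive decreasing functions is automatic: otherwise functions `H n`
of norm at most `2⁻ⁿ` with `∫₀ᵗ (T (H n))* = 1` add up to a function in `X` whose image is not
in `L¹ + L^∞`. -/
lemma ClassH.exists_rearrInt_le (hT : ClassH h T) (hX : IsRISpace ρ) (t : ℝ) :
    ∃ C : ℝ≥0, ∀ G : h.space, IsPosDecr (G : L0) →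
      rearrInt (T G) t ≤ C * ρ G := by
  by_contra! hcon
  choose G hG hlt using fun n : ℕ => hcon (2 ^ n)
  have hKtop : ∀ n, rearrInt (T (G n)) t ≠ ∞ := fun n =>
    (rearrInt_lt_top_of_mem (T (G n)).2 t).ne
  have hK0 : ∀ n, rearrInt (T (G n)) t ≠ 0 := fun n => (pos_of_gt (hlt n)).ne'
  -- normalize so that `∫₀ᵗ (T (H n))* = 1`
  set c : ℕ → ℝ := fun n => ((rearrInt (T (G n)) t).toReal)⁻¹ with hc
  have hcpos : ∀ n, 0 < c n := fun n => inv_pos.2 (ENNReal.toReal_pos (hK0 n) (hKtop n))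
  have hce : ∀ n, ‖c n‖ₑ = (rearrInt (T (G n)) t)⁻¹ := by
    intro n
    rw [Real.enorm_of_nonneg (hcpos n).le, hc,
      ENNReal.ofReal_inv_of_pos (ENNReal.toReal_pos (hK0 n) (hKtop n)),
      ENNReal.ofReal_toReal (hKtop n)]
  set H : ℕ → h.space := fun n => c n • G n with hH
  have hHdec : ∀ n, IsPosDecr (H n : L0) := fun n => (hG n).smul (hcpos n).le
  have hHone : ∀ n, rearrInt (T (H n)) t = 1 := by
    intro n
    rw [hH]
    simp only [map_smul, Submodule.coe_smul]
    rw [rearrInt_smul, hce, ENNReal.inv_mul_cancel (hK0 n) (hKtop n)]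
  have hHnorm : ∀ n, ρ (H n) ≤ 2⁻¹ ^ n := by
    intro n
    have h1 : ρ (H n) = ‖c n‖ₑ * ρ (G n) := hX.smul _ _
    have h2 : (2 : ℝ≥0∞) ^ n * ρ (G n) ≤ rearrInt (T (G n)) t := by
      simpa using (hlt n).le
    have h3 : ρ (G n) ≤ 2⁻¹ ^ n * rearrInt (T (G n)) t := by
      calc ρ (G n) = 2⁻¹ ^ n * (2 ^ n * ρ (G n)) := by
            rw [← mul_assoc, ← mul_pow, ENNReal.inv_mul_cancel (by simp) (by simp), one_pow,
              one_mul]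
        _ ≤ _ := by gcongr
    calc ρ (H n) = ‖c n‖ₑ * ρ (G n) := h1
      _ ≤ (rearrInt (T (G n)) t)⁻¹ * (2⁻¹ ^ n * rearrInt (T (G n)) t) := by
          rw [hce]
          gcongr
      _ = 2⁻¹ ^ n := by
          rw [mul_left_comm, ENNReal.inv_mul_cancel (hK0 n) (hKtop n), mul_one]
  have hsum : ∑' n, ρ (H n) < ∞ := by
    refine lt_of_le_of_lt (ENNReal.tsum_le_tsum hHnorm) ?_
    rw [ENNReal.tsum_geometric]
    simp
  obtain ⟨F, hF, hFdec⟩ := hX.exists_sum hHdec hsum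
  have htop := hT.tsum_rearrInt_le hHdec (F := ⟨F, lt_of_le_of_lt hF hsum⟩) hFdec t
  simp only [hHone] at htop
  rw [ENNReal.tsum_const_eq_top_of_ne_zero one_ne_zero] at htop
  exact absurd (rearrInt_lt_top_of_mem (T _).2 t) (not_lt.2 htop)

/-! ### The norm of the optimal range -/

/-- It suffices to test `rangeNorm` with positive decreasing functions, for which `g* = g`; the
condition `f ∈ L¹ + L^∞` follows from `f ≺ T g`. -/
lemma rangeNorm_le {f : L0} {G : h.space} (hG : IsPosDecr (G : L0)) (hf : HLP f (T G)) :
    rangeNorm h T f ≤ ρ G := by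
  refine iInf₂_le G ⟨hf.mem_L1Linf (T G).2, ?_⟩
  rw [h.rearrangement_eq hG]
  exact (maxFun_le_maxFun_iff _ _).2 hf

lemma exists_of_rangeNorm_lt {f : L0} {c : ℝ≥0∞} (hc : rangeNorm h T f < c) :
    ∃ G : h.space, IsPosDecr (G : L0) ∧ HLP f (T G) ∧ ρ G < c := by
  simp only [rangeNorm, iInf_lt_iff] at hc
  obtain ⟨g, ⟨-, hg⟩, hlt⟩ := hc
  exact ⟨h.rearrangement g, h.isPosDecr_rearrangement g, (maxFun_le_maxFun_iff _ _).1 hg,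
    (h.norm_rearrangement_le g).trans_lt hlt⟩

lemma rangeNorm_mono {f g : L0} (hfg : HLP f g) : rangeNorm h T f ≤ rangeNorm h T g := by
  refine le_of_forall_gt fun c hc => ?_
  obtain ⟨G, hG, hgG, hlt⟩ := exists_of_rangeNorm_lt hc
  exact (rangeNorm_le hG fun t ht => (hfg t ht).trans (hgG t ht)).trans_lt hlt

lemma rangeNorm_zero : rangeNorm h T 0 = 0 := by
  refine le_antisymm ?_ zero_le
  refine (rangeNorm_le (G := 0) IsPosDecr.zero fun t ht => ?_).trans
    ((h.eq_zero_iff 0).2 rfl).le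
  show rearrInt 0 t ≤ _
  rw [rearrInt_zero]
  exact zero_le

lemma rangeNorm_smul_le (c : ℝ) (f : L0) :
    rangeNorm h T (c • f) ≤ ‖c‖ₑ * rangeNorm h T f := by
  rcases eq_or_ne c 0 with rfl | hc
  · simp [rangeNorm_zero]
  have hc' : ‖c‖ₑ ≠ 0 := by simpa using hc
  rw [mul_comm, ← ENNReal.div_le_iff_le_mul (Or.inl hc') (Or.inl enorm_ne_top)]
  refine le_of_forall_gt fun d hd => ?_
  obtain ⟨G, hG, hfG, hlt⟩ := exists_of_rangeNorm_lt hd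
  have hle : rangeNorm h T (c • f) ≤ ‖c‖ₑ * ρ G := by
    have hn : ρ (|c| • G : h.space) = ‖c‖ₑ * ρ G := by
      rw [← Real.enorm_abs]
      exact h.smul _ _
    rw [← hn]
    refine rangeNorm_le (hG.smul (abs_nonneg c)) fun t ht => ?_
    rw [map_smul, Submodule.coe_smul]
    change rearrInt _ t ≤ rearrInt _ t
    rw [rearrInt_smul, rearrInt_smul, Real.enorm_abs]
    exact mul_le_mul_right (hfG t ht) _
  refine lt_of_le_of_lt ?_ hlt
  rwa [ENNReal.div_le_iff_le_mul (Or.inl hc') (Or.inl enorm_ne_top), mul_comm]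

lemma rangeNorm_smul (c : ℝ) (f : L0) :
    rangeNorm h T (c • f) = ‖c‖ₑ * rangeNorm h T f := by
  refine le_antisymm (rangeNorm_smul_le c f) ?_
  rcases eq_or_ne c 0 with rfl | hc
  · simp
  · have h1 := rangeNorm_smul_le (h := h) (T := T) c⁻¹ (c • f)
    rw [smul_smul, inv_mul_cancel₀ hc, one_smul] at h1
    calc ‖c‖ₑ * rangeNorm h T f ≤ ‖c‖ₑ * (‖c⁻¹‖ₑ * rangeNorm h T (c • f)) := by gcongr
      _ = _ := by rw [← mul_assoc, ← enorm_mul, mul_inv_cancel₀ hc, enorm_one, one_mul]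

lemma ClassH.rangeNorm_add_le (hT : ClassH h T) (f g : L0) :
    rangeNorm h T (f + g) ≤ rangeNorm h T f + rangeNorm h T g := by
  refine ENNReal.le_of_forall_pos_le_add fun ε hε hfin => ?_
  rw [ENNReal.add_lt_top] at hfin
  have hε2 : ((ε : ℝ≥0∞) / 2) ≠ 0 := by simpa using hε.ne'
  obtain ⟨G, hG, hfG, hltG⟩ := exists_of_rangeNorm_lt (ENNReal.lt_add_right hfin.1.ne hε2)
  obtain ⟨H, hH, hgH, hltH⟩ := exists_of_rangeNorm_lt (ENNReal.lt_add_right hfin.2.ne hε2)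
  calc rangeNorm h T (f + g) ≤ ρ (G + H : h.space) := by
        refine rangeNorm_le (hG.add hH) fun t ht => ?_
        rw [map_add, Submodule.coe_add]
        change rearrInt _ t ≤ rearrInt _ t
        rw [(hT.decreasing _ hG).rearrInt_add (hT.decreasing _ hH)]
        exact (rearrInt_add_le f g t).trans (add_le_add (hfG t ht) (hgH t ht))
    _ ≤ ρ G + ρ H := h.add_le _ _
    _ ≤ (rangeNorm h T f + ε / 2) + (rangeNorm h T g + ε / 2) := add_le_add hltG.le hltH.le
    _ = rangeNorm h T f + rangeNorm h T g + ε := by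
        rw [add_add_add_comm, ENNReal.add_halves]

lemma ClassH.rangeNorm_apply_le (hT : ClassH h T) (f : h.space) : rangeNorm h T (T f) ≤ ρ f :=
  (rangeNorm_le (h.isPosDecr_rearrangement f) (hT.hlp_monotone f)).trans
    (h.norm_rearrangement_le f)

lemma rearr_charFn_le {E : Set ℝ} (hE : MeasurableSet E) {u : ℝ}
    (hEu : halfLine E = ENNReal.ofReal u) (t : ℝ) :
    rearr (charFn E hE) t ≤ rearr (charFn (Ioo 0 u) measurableSet_Ioo) t := by
  have hset : ∀ (A : Set ℝ) (hA : MeasurableSet A) (s : ℝ≥0∞),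
      halfLine {x | s < ‖charFn A hA x‖ₑ} = if s < 1 then halfLine A else 0 := by
    intro A hA s
    have heq : halfLine {x | s < ‖charFn A hA x‖ₑ}
        = halfLine {x | s < ‖A.indicator (fun _ => (1 : ℝ)) x‖ₑ} := by
      refine measure_congr ?_
      filter_upwards [coeFn_charFn hA] with x hx
      show (s < ‖charFn A hA x‖ₑ) = _
      rw [hx]
      rfl
    rw [heq]
    split_ifs with hs
    · congr 1
      ext x
      by_cases hx : x ∈ A <;> simp [hx, hs]
    · convert measure_empty (μ := halfLine)
      ext x
      by_cases hx : x ∈ A <;> simp [hx, not_lt.1 hs]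
  simp only [rearr, hset]
  rw [hEu, halfLine_Ioo]

lemma isPosDecr_charFn_Ioo (u : ℝ) : IsPosDecr (charFn (Ioo 0 u) measurableSet_Ioo) := by
  refine ⟨(Ioo 0 u).indicator fun _ => (1 : ℝ), fun a ha b hb hab => ?_,
    fun t _ => indicator_nonneg (fun _ _ => zero_le_one) t, AEEqFun.coeFn_mk _ _⟩
  by_cases hbu : b ∈ Ioo 0 u
  · rw [indicator_of_mem hbu, indicator_of_mem (show a ∈ Ioo 0 u from ⟨ha, hab.trans_lt hbu.2⟩)]
  · rw [indicator_of_notMem hbu]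
    exact indicator_nonneg (fun _ _ => zero_le_one) a

/-- For positive decreasing functions in `L¹ + L^∞`, the inequality `S f ≤ S g` is the relation
`f ≺ g`. -/
lemma hlp_of_hardy_le {f g : L0} (hf : IsPosDecr f) (hg : IsPosDecr g) (hgL : g ∈ L1Linf)
    (hfL : f ∈ L1Linf) (hle : ∀ s : ℝ, 0 < s → hardy f s ≤ hardy g s) : HLP f g := by
  have key : ∀ {k : L0}, IsPosDecr k → k ∈ L1Linf → ∀ {t : ℝ}, 0 < t →
      rearrInt k t = ENNReal.ofReal (∫ s in Ioo 0 t, k s ∂halfLine) := by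
    intro k hk hkL t ht
    rw [hk.rearrInt_eq, ← ofReal_integral_norm_eq_lintegral_enorm]
    · congr 1
      refine integral_congr_ae (ae_restrict_of_ae ?_)
      filter_upwards [hk.nonneg] with x hx
      exact Real.norm_of_nonneg hx
    · refine ⟨k.measurable.aestronglyMeasurable, ?_⟩
      show ∫⁻ x in Ioo 0 t, ‖k x‖ₑ ∂halfLine < ∞
      rw [← hk.rearrInt_eq]
      exact rearrInt_lt_top_of_mem hkL t
  intro t ht
  change rearrInt f t ≤ rearrInt g t
  rw [key hf hfL ht, key hg hgL ht]
  exact ENNReal.ofReal_le_ofReal ((mul_le_mul_iff_right₀ (inv_pos.2 ht)).1 (hle t ht))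

lemma charFn_mem_L1Linf (u : ℝ) : charFn (Ioo 0 u) measurableSet_Ioo ∈ L1Linf := by
  refine mem_L1Linf_of_rearrInt_lt_top one_pos ?_
  rw [(isPosDecr_charFn_Ioo u).rearrInt_eq]
  refine lt_of_le_of_lt (lintegral_mono_ae (g := fun _ => 1) (ae_restrict_of_ae ?_)) ?_
  · filter_upwards [coeFn_charFn (measurableSet_Ioo (a := 0) (b := u))] with x hx
    rw [hx]
    by_cases hxu : x ∈ Ioo 0 u <;> simp [hxu]
  · rw [lintegral_one, Measure.restrict_apply_univ]
    exact halfLine_Ioo_lt_top 1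

/-- The function `χ_(0,|E|)` is a competitor for `χ_E`, by the lower bound in the definition of
class `𝓗`. -/
lemma ClassH.rangeNorm_charFn_lt_top (hT : ClassH h T) {E : Set ℝ} (hE : MeasurableSet E)
    (hfin : halfLine E < ∞) : rangeNorm h T (charFn E hE) < ∞ := by
  rcases eq_or_ne (halfLine E) 0 with h0 | h0
  · have : charFn E hE = 0 := by
      refine AEEqFun.ext ?_
      have hnot : ∀ᵐ x ∂halfLine, x ∉ E := measure_eq_zero_iff_ae_notMem.1 h0
      filter_upwards [coeFn_charFn hE, hnot,
        (AEEqFun.coeFn_zero : ⇑(0 : L0) =ᵐ[halfLine] 0)] with x hx1 hx2 hx3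
      rw [hx1, hx3, indicator_of_notMem hx2]
      rfl
    rw [this, rangeNorm_zero]
    exact ENNReal.zero_lt_top
  · set u := (halfLine E).toReal with hu
    have hu0 : 0 < u := ENNReal.toReal_pos h0 hfin.ne
    have hEu : halfLine E = ENNReal.ofReal u := (ENNReal.ofReal_toReal hfin.ne).symm
    refine lt_of_le_of_lt (rangeNorm_le (G := h.charIoo u) (isPosDecr_charFn_Ioo u)
      fun t ht => ?_) (h.charIoo u).2
    have hlp : HLP (h.charIoo u : L0) (T (h.charIoo u)) :=
      hlp_of_hardy_le (isPosDecr_charFn_Ioo u) (hT.decreasing _ (isPosDecr_charFn_Ioo u))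
        (T _).2 (charFn_mem_L1Linf u) (hT.restricted_lower u hu0)
    refine le_trans (lintegral_mono fun x => ?_) (hlp t ht)
    exact rearr_charFn_le hE hEu x

lemma ClassH.exists_rearrInt_le_rangeNorm (hT : ClassH h T) (hX : IsRISpace ρ) {t : ℝ}
    (ht : 0 < t) :
    ∃ C : ℝ≥0, ∀ f : L0, rearrInt f t ≤ C * rangeNorm h T f := by
  obtain ⟨C, hC⟩ := hT.exists_rearrInt_le hX t
  -- a positive constant is needed when the right-hand norm is infinite, since `0 * ∞ = 0`
  refine ⟨C + 1, fun f => ?_⟩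
  have h0 : ((C + 1 : ℝ≥0) : ℝ≥0∞) ≠ 0 := by simp
  rw [mul_comm, ← ENNReal.div_le_iff_le_mul (Or.inl h0) (Or.inl ENNReal.coe_ne_top)]
  refine le_of_forall_gt fun d hd => ?_
  obtain ⟨G, hG, hfG, hlt⟩ := exists_of_rangeNorm_lt hd
  refine lt_of_le_of_lt ?_ hlt
  rw [ENNReal.div_le_iff_le_mul (Or.inl h0) (Or.inl ENNReal.coe_ne_top), mul_comm]
  refine (hfG t ht).trans ((hC G hG).trans ?_)
  gcongr
  exact le_self_add

lemma ClassH.exists_setLIntegral_le_rangeNorm (hT : ClassH h T) (hX : IsRISpace ρ) {E : Set ℝ}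
    (hE : halfLine E < ∞) :
    ∃ C : ℝ≥0, ∀ f : L0,
      ∫⁻ x in E, ‖f x‖ₑ ∂halfLine ≤ C * rangeNorm h T f := by
  have ht : 0 < (halfLine E).toReal + 1 := by positivity
  obtain ⟨C, hC⟩ := hT.exists_rearrInt_le_rangeNorm hX ht
  refine ⟨C, fun f => (setLIntegral_le_rearrInt f ?_).trans (hC f)⟩
  calc halfLine E = ENNReal.ofReal (halfLine E).toReal := (ENNReal.ofReal_toReal hE.ne).symm
    _ ≤ _ := ENNReal.ofReal_le_ofReal (by linarith)

lemma ClassH.rangeNorm_eq_zero_iff (hT : ClassH h T) (hX : IsRISpace ρ) (f : L0) :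
    rangeNorm h T f = 0 ↔ f = 0 := by
  refine ⟨fun hf => AEEqFun.ext ?_, fun hf => hf ▸ rangeNorm_zero⟩
  have hk : ∀ k : ℕ, ∀ᵐ x ∂halfLine, x ∈ Ioo 0 (k : ℝ) → ‖f x‖ₑ = 0 := by
    intro k
    obtain ⟨C, hC⟩ := hT.exists_setLIntegral_le_rangeNorm hX (halfLine_Ioo_lt_top k)
    have h0 := hC f
    rw [hf, mul_zero, nonpos_iff_eq_zero, lintegral_eq_zero_iff (measurable_enorm_coe f)] at h0
    exact (ae_restrict_iff' measurableSet_Ioo).1 h0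
  filter_upwards [ae_all_iff.2 hk, ae_restrict_mem measurableSet_Ioi,
    (AEEqFun.coeFn_zero : ⇑(0 : L0) =ᵐ[halfLine] 0)] with x hx hx0 hx1
  obtain ⟨k, hxk⟩ := exists_nat_gt x
  rw [hx1]
  exact enorm_eq_zero.1 (hx k ⟨hx0, hxk⟩)

/-- Countable subadditivity: competitors for the `f n` that are almost optimal add up to a
competitor for `F`. -/
lemma ClassH.rangeNorm_le_tsum (hT : ClassH h T) (hX : IsRISpace ρ) {F : L0} {f : ℕ → L0}
    (hF : ∀ᵐ x ∂halfLine, ‖F x‖ₑ ≤ ∑' n, ‖f n x‖ₑ) :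
    rangeNorm h T F ≤ ∑' n, rangeNorm h T (f n) := by
  refine ENNReal.le_of_forall_pos_le_add fun ε hε hfin => ?_
  obtain ⟨δ, hδ, hδε⟩ := ENNReal.exists_pos_sum_of_countable
    (ENNReal.coe_ne_zero.2 hε.ne') ℕ
  choose G hG hfG hlt using fun n => exists_of_rangeNorm_lt
    (ENNReal.lt_add_right (ENNReal.ne_top_of_tsum_ne_top hfin.ne n)
      (ENNReal.coe_ne_zero.2 (hδ n).ne'))
  have hGsum : ∑' n, ρ (G n) ≤ ∑' n, rangeNorm h T (f n) + ε := by
    refine (ENNReal.tsum_le_tsum fun n => (hlt n).le).trans ?_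
    rw [ENNReal.tsum_add]
    gcongr
  have hGtop : ∑' n, ρ (G n) < ∞ :=
    hGsum.trans_lt (ENNReal.add_lt_top.2 ⟨hfin, ENNReal.coe_lt_top⟩)
  obtain ⟨S, hS, hSdec⟩ := hX.exists_sum hG hGtop
  refine le_trans (rangeNorm_le (G := ⟨S, hS.trans_lt hGtop⟩) (by simpa using hSdec 0)
    fun t ht => ?_) (hS.trans hGsum)
  calc rearrInt F t ≤ ∑' n, rearrInt (f n) t := rearrInt_le_tsum hF t
    _ ≤ ∑' n, rearrInt (T (G n)) t := ENNReal.tsum_le_tsum fun n => hfG n t ht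
    _ ≤ _ := hT.tsum_rearrInt_le hG hSdec t

lemma ClassH.rangeNorm_riesz_fischer (hT : ClassH h T) (hX : IsRISpace ρ) (f : ℕ → L0)
    (hf : ∑' n, rangeNorm h T (f n) < ∞) :
    ∃ g : L0, Tendsto (fun N => rangeNorm h T (g - ∑ n ∈ Finset.range N, f n))
      atTop (𝓝 0) ∧
      rangeNorm h T g ≤ ∑' n, rangeNorm h T (f n) := by
  have hae : ∀ᵐ x ∂halfLine, ∑' n, ‖f n x‖ₑ < ∞ := by
    refine ae_tsum_enorm_lt_top fun k => ?_
    obtain ⟨C, hC⟩ := hT.exists_setLIntegral_le_rangeNorm hX (halfLine_Ioo_lt_top k)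
    refine lt_of_le_of_lt (ENNReal.tsum_le_tsum fun n => hC (f n)) ?_
    rw [ENNReal.tsum_mul_left]
    exact ENNReal.mul_lt_top ENNReal.coe_lt_top hf
  obtain ⟨g, hg⟩ := exists_hasSum_ae hae
  have htail : ∀ N, rangeNorm h T (g - ∑ n ∈ Finset.range N, f n)
      ≤ ∑' n, rangeNorm h T (f (n + N)) := by
    intro N
    refine hT.rangeNorm_le_tsum hX ?_
    filter_upwards [hg, AEEqFun.coeFn_sub g (∑ n ∈ Finset.range N, f n),
      coeFn_sum_range f N] with x hx hx2 hx3
    have htsum : (g - ∑ n ∈ Finset.range N, f n : L0) x = ∑' n, f (n + N) x := by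
      rw [hx2, Pi.sub_apply, hx3, ← hx.tsum_eq, ← hx.summable.sum_add_tsum_nat_add N]
      ring
    rw [htsum]
    exact enorm_tsum_le_tsum_enorm
  refine ⟨g, ?_, by simpa using htail 0⟩
  exact tendsto_of_tendsto_of_tendsto_of_le_of_le tendsto_const_nhds
    (ENNReal.tendsto_sum_nat_add _ hf.ne) (fun _ => zero_le) htail

lemma ClassH.isMonotoneRieszFischer_rangeNorm (hT : ClassH h T) (hX : IsRISpace ρ) :
    IsMonotoneRieszFischer (rangeNorm h T) where
  eq_zero_iff := hT.rangeNorm_eq_zero_iff hX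
  smul := rangeNorm_smul
  add_le := hT.rangeNorm_add_le
  mono _ _ hfg := rangeNorm_mono fun _ _ => setLIntegral_mono' measurableSet_Ioo
    fun x hx => hfg x hx.1
  charFn_lt_top _ hE hfin := hT.rangeNorm_charFn_lt_top hE hfin
  setLIntegral_le _ _ hfin := hT.exists_setLIntegral_le_rangeNorm hX hfin
  riesz_fischer := hT.rangeNorm_riesz_fischer hX
  hlp_mono _ _ := rangeNorm_mono

lemma embedsInto_of_boundedInto {τ : L0 → ℝ≥0∞} (hτ : IsMonotoneRieszFischer τ)
    (hb : BoundedInto h T τ) : EmbedsInto (rangeNorm h T) τ := by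
  obtain ⟨C, hC⟩ := hb
  refine ⟨C, fun f hf => le_of_forall_gt fun d hd => ?_⟩
  -- for `C = 0` the finiteness of `rangeNorm h T f` is what leaves room for `c`
  obtain ⟨c, hc, hcd⟩ : ∃ c, rangeNorm h T f < c ∧ (C : ℝ≥0∞) * c < d := by
    rcases eq_or_ne C 0 with rfl | hC0
    · exact ⟨∞, hf, by simpa using hd⟩
    · have hC0' : (C : ℝ≥0∞) ≠ 0 := by simpa using hC0
      rw [mul_comm, ← ENNReal.lt_div_iff_mul_lt (Or.inl hC0') (Or.inl ENNReal.coe_ne_top)] at hd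
      obtain ⟨c, hc, hcd⟩ := exists_between hd
      rw [ENNReal.lt_div_iff_mul_lt (Or.inl hC0') (Or.inl ENNReal.coe_ne_top), mul_comm] at hcd
      exact ⟨c, hc, hcd⟩
  obtain ⟨G, -, hfG, hlt⟩ := exists_of_rangeNorm_lt hc
  calc τ f ≤ C * ρ G := (hτ.hlp_mono _ _ hfG).trans (hC G)
    _ ≤ C * c := by gcongr
    _ < d := hcd

end OptimalRange

open OptimalRange in
theorem theorem3p2 (ρ : L0 → ℝ≥0∞) (hX : IsRISpace ρ)
    (T : hX.toIsRINorm.space →ₗ[ℝ] L1Linf) (hT : ClassH hX.toIsRINorm T) :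
    IsOptimalMonotoneRange hX.toIsRINorm T (rangeNorm hX.toIsRINorm T) where
  isMonotoneRieszFischer := hT.isMonotoneRieszFischer_rangeNorm hX
  bounded := ⟨1, fun f => by simpa using hT.rangeNorm_apply_le f⟩
  optimal _ hτ hb := embedsInto_of_boundedInto hτ hb
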